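/- **Theorem 1 (Optimal stationary policy and RVI optimality).** *Model.* Fix integers $m^\star\ge 1$ and $\Delta_{\max}\ge 1$, probabilities $p_L,p_{sw}\in[0,1]$, and stochastic $2\times 2$ matrices $\mathbf P_{12},\mathbf P_{23}$ indexed by $\{0,1\}$ ($0$ = invisible, $1$ = visible) such that $[\mathbf P_{12}]_{i,0}>0$ and $[\mathbf P_{23}]_{i,0}>0$ for $i=0,1$ (from either visibility state a link is invisible in the next slot with positive probability). Consider the Markov decision process with states $s=(v^{12},v^{23},m^{12},m^{23},\Delta)$, where $v^{12},v^{23}\in\{0,1\}$, $m^{12},m^{23}\in\{-1,1,2,\dots,m^\star\}$ and $\Delta\in\{1,\dots,\Delta_{\max}\}$, and actions $a=(a^{12},a^{23},a^{sw})\in\{0,1\}^3$. The action $a$ is admissible in $s$, written $a\in\mathcal A(s)$, if: $a^{sw}=1$ implies $a^{12}=a^{23}=0$, $m^{12}\ge1$ and $m^{23}\ge 1$; $a^{12}=1$ implies $v^{12}=1$; and $a^{23}=1$ implies $v^{23}=1$. The visibilities $v^{12},v^{23}$ evolve as independent Markov chains with transition matrices $\mathbf P_{12},\mathbf P_{23}$,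 independently of the rest of the transition. If $a^{sw}=1$, both link ages become $-1$, and $\Delta$ becomes $\min(m^{12}+m^{23},\Delta_{\max})$ with probability $p_{sw}$ and $\min(\Delta+1,\Delta_{\max})$ otherwise. If $a^{sw}=0$, then $\Delta$ becomes $\min(\Delta+1,\Delta_{\max})$ and, independently for $\ell\in\{12,23\}$: if $a^{\ell}=1$, then $m^\ell$ becomes $1$ with probability $p_L$ and $-1$ otherwise; if $a^\ell=0$, then $m^\ell$ becomes $m^\ell+1$ when $1\le m^\ell<m^\star$, and $-1$ otherwise. The reward of a transition from $s$ to $s'$ is $r(s,a,s')=-\Delta'$, where $\Delta'$ is the last component of $s'$. Write $P(s'\mid s,a)$ for the transition probabilities. *Optimality.* For a (possibly history-dependent and randomized) policy $\pi$ using only admissible actions, and an initial state $s$, let $$\eta^\pi(s)=\liminf_{T\to\infty}\frac1T\,\mathbb E_\pi\Big[\sum_{t=0}^{T-1} r(s_t,a_t,s_{t+1})\,\Big|\,s_0=s\Big],\qquad c^\pi(s)=\liminf_{T\to\infty}\frac1T\,\mathbb E_\pi\Big[\sum_{t=0}^{T-1}\Delta_{t+1}\,\Big|\,s_0=s\Big].$$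 Call $\pi$ *average optimal* if $\eta^\pi(s)\ge\eta^{\pi'}(s)$ and $c^{\pi}(s)\le c^{\pi'}(s)$ for every policy $\pi'$ and every state $s$. *Relative value iteration (RVI).* For $h:\mathcal S\to\mathbb R$ let $$Q_h(s,a)=\sum_{s'}P(s'\mid s,a)\big[r(s,a,s')+h(s')\big],\qquad (Lh)(s)=\max_{a\in\mathcal A(s)}Q_h(s,a),$$ and call a stationary deterministic policy $f$ *greedy for $h$* if $f(s)\in\arg\max_{a\in\mathcal A(s)}Q_h(s,a)$ for all $s$. Given a reference state $s_{\rm ref}$, put $h^{(0)}=0$ and $h^{(k)}=Lh^{(k-1)}-(Lh^{(k-1)})(s_{\rm ref})$. With tolerance $\varepsilon>0$, RVI stops at the first $k\ge1$ with $\max_s|h^{(k)}(s)-h^{(k-1)}(s)|<\varepsilon$ and returns a policy that is greedy for $h^{(k-1)}$, ties being broken arbitrarily. *Claim.* 1. There is an average optimal stationary deterministic policy. 2. For every $s_{\rm ref}$, the iterates $h^{(k)}$ converge to a function $h$ which, with some constant $g\in\mathbb R$, satisfies $g+h(s)=(Lh)(s)$ for all $s$. Every stationary deterministic policy that is greedy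 for $h$ is average optimal and has $\eta^{\pi}(s)=g$ for all $s$. For all sufficiently large $k$, every policy that is greedy for $h^{(k)}$ is average optimal. 3. For every $s_{\rm ref}$ and every $\varepsilon>0$, RVI stops after finitely many iterations, and every policy $f$ that it may return satisfies $\eta^{f}(s)\ge\eta^{\pi'}(s)-2\varepsilon$ for all policies $\pi'$ and all states $s$. Moreover there is $\varepsilon_0>0$ (which may depend on the model and on $s_{\rm ref}$) such that for all $0<\varepsilon<\varepsilon_0$ every policy that RVI may return is average optimal. -/

import Mathlib

open Filter Topology

noncomputable section

/-! ## Finite Markov decision processes with average reward -/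

/-- A Markov decision process with finite state space `S` and finite action space `A`:
admissible actions, transition probabilities `P s a s'` and rewards `r s a s'`. -/
structure FiniteMDP (S A : Type) [Fintype S] where
  adm : S → Finset A
  P : S → A → S → ℝ
  r : S → A → S → ℝ
  adm_nonempty : ∀ s, (adm s).Nonempty
  P_nonneg : ∀ s, ∀ a ∈ adm s, ∀ s', 0 ≤ P s a s'
  P_sum : ∀ s, ∀ a ∈ adm s, ∑ s', P s a s' = 1

namespace FiniteMDP

variable {S A : Type} [Fintype S] [DecidableEq S] [Fintype A] [DecidableEq A]

/-- A history-dependent randomized policy: `prob t h s a` is the probability of choosing `a` at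
time `t` when the past states and actions are `h` and the current state is `s`. -/
structure Policy (M : FiniteMDP S A) where
  prob : (t : ℕ) → (Fin t → S × A) → S → A → ℝ
  nonneg : ∀ t h s a, 0 ≤ prob t h s a
  sum_eq_one : ∀ t h s, ∑ a, prob t h s a = 1
  adm_of_ne_zero : ∀ t h s a, prob t h s a ≠ 0 → a ∈ M.adm s

/-- A stationary deterministic policy: a map from states to admissible actions. -/
def Stationary (M : FiniteMDP S A) : Type := {f : S → A // ∀ s, f s ∈ M.adm s}

/-- A stationary deterministic policy, seen as a policy. -/
def Stationary.toPolicy {M : FiniteMDP S A} (f : M.Stationary) : M.Policy where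
  prob _ _ s a := if a = f.1 s then 1 else 0
  nonneg _ _ s a := by split_ifs <;> norm_num
  sum_eq_one _ _ s := by simp
  adm_of_ne_zero _ _ s a h := by
    by_cases e : a = f.1 s
    · rw [e]; exact f.2 s
    · simp [e] at h

/-- Probability, under `π` and from the initial state `s₀`, that the states and actions at times
`0, …, t - 1` are those in `h` and that the state at time `t` is `s`. -/
def pathProb (M : FiniteMDP S A) (π : M.Policy) (s₀ : S) : (t : ℕ) → (Fin t → S × A) → S → ℝ
  | 0, _, s => if s = s₀ then 1 else 0
  | t + 1, h, s =>
      pathProb M π s₀ t (Fin.init h) (h (Fin.last t)).1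
        * π.prob t (Fin.init h) (h (Fin.last t)).1 (h (Fin.last t)).2
        * M.P (h (Fin.last t)).1 (h (Fin.last t)).2 s

/-- Expectation of `c (s_t, a_t, s_{t+1})` under `π` from the initial state `s₀`. -/
def expect (M : FiniteMDP S A) (π : M.Policy) (s₀ : S) (c : S → A → S → ℝ) (t : ℕ) : ℝ :=
  ∑ h : Fin (t + 1) → S × A, ∑ s : S,
    M.pathProb π s₀ (t + 1) h s * c (h (Fin.last t)).1 (h (Fin.last t)).2 s

/-- `liminf_T (1/T) E_π [∑_{t<T} c (s_t, a_t, s_{t+1})]`. -/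
def longRunAverage (M : FiniteMDP S A) (π : M.Policy) (s₀ : S) (c : S → A → S → ℝ) : ℝ :=
  liminf (fun T : ℕ => (1 / (T : ℝ)) * ∑ t ∈ Finset.range T, M.expect π s₀ c t) atTop

/-- The long-run expected average reward. -/
def avgReward (M : FiniteMDP S A) (π : M.Policy) (s₀ : S) : ℝ := M.longRunAverage π s₀ M.r

/-- The long-run expected average cost, the cost being minus the reward. -/
def avgCost (M : FiniteMDP S A) (π : M.Policy) (s₀ : S) : ℝ :=
  M.longRunAverage π s₀ (fun s a s' => -M.r s a s')

/-- `π` maximizes the average reward and minimizes the average cost, from every initial state,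
among all history-dependent randomized policies. (Both criteria are a `liminf`, so neither is
just the negative of the other.) -/
def IsAverageOptimal (M : FiniteMDP S A) (π : M.Policy) : Prop :=
  ∀ (π' : M.Policy) (s : S),
    M.avgReward π' s ≤ M.avgReward π s ∧ M.avgCost π s ≤ M.avgCost π' s

/-! ### Relative value iteration -/

/-- `Q(s, a) = ∑_{s'} P(s' | s, a) (r(s, a, s') + h(s'))`. -/
def Q (M : FiniteMDP S A) (h : S → ℝ) (s : S) (a : A) : ℝ :=
  ∑ s', M.P s a s' * (M.r s a s' + h s')

/-- `max_{a ∈ A(s)} Q(s, a)`. -/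
def bellman (M : FiniteMDP S A) (h : S → ℝ) (s : S) : ℝ :=
  (M.adm s).sup' (M.adm_nonempty s) (M.Q h s)

/-- `f s ∈ argmax_{a ∈ A(s)} Q(s, a)` for every `s`. -/
def IsGreedy (M : FiniteMDP S A) (h : S → ℝ) (f : M.Stationary) : Prop :=
  ∀ s, ∀ a ∈ M.adm s, M.Q h s a ≤ M.Q h s (f.1 s)

/-- The iterates of relative value iteration with reference state `sref`. -/
def rvi (M : FiniteMDP S A) (sref : S) : ℕ → S → ℝ
  | 0 => fun _ => 0
  | k + 1 => fun s => M.bellman (rvi M sref k) s - M.bellman (rvi M sref k) sref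

/-- The iterations `k ≥ 1` at which the stopping test with tolerance `ε` succeeds. -/
def rviStopSet (M : FiniteMDP S A) (sref : S) (ε : ℝ) : Set ℕ :=
  {k | 1 ≤ k ∧ ∀ s, |M.rvi sref k s - M.rvi sref (k - 1) s| < ε}

/-- `f` may be returned by relative value iteration with tolerance `ε`: it is greedy at the first
iteration `k` at which the stopping test succeeds (ties in the argmax are broken arbitrarily). -/
def IsRVIOutput (M : FiniteMDP S A) (sref : S) (ε : ℝ) (f : M.Stationary) : Prop :=
  ∃ k, IsLeast (M.rviStopSet sref ε) k ∧ M.IsGreedy (M.rvi sref (k - 1)) f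

end FiniteMDP

/-! ## The single-satellite repeater chain -/

/-- Parameters: the link-age cutoff, the cap on the age of entanglement, the success probabilities
of link generation and of swapping, and the visibility transition matrices
(state `0` is invisible, state `1` is visible). -/
structure RepeaterChain where
  mstar : ℕ
  Dmax : ℕ
  pL : ℝ
  psw : ℝ
  P12 : Matrix (Fin 2) (Fin 2) ℝ
  P23 : Matrix (Fin 2) (Fin 2) ℝ
  one_le_mstar : 1 ≤ mstar
  one_le_Dmax : 1 ≤ Dmax
  pL_nonneg : 0 ≤ pL
  pL_le_one : pL ≤ 1
  psw_nonneg : 0 ≤ psw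
  psw_le_one : psw ≤ 1
  P12_nonneg : ∀ i j, 0 ≤ P12 i j
  P12_sum : ∀ i, ∑ j, P12 i j = 1
  P23_nonneg : ∀ i j, 0 ≤ P23 i j
  P23_sum : ∀ i, ∑ j, P23 i j = 1

namespace RepeaterChain

/-- Ages of an elementary link: `-1` (no link) or `1, …, m*`. -/
abbrev LinkAge (R : RepeaterChain) : Type :=
  {m : ℤ // m ∈ insert (-1 : ℤ) (Finset.Icc (1 : ℤ) R.mstar)}

/-- Values `1, …, Δ_max` of the age of entanglement. -/
abbrev AoE (R : RepeaterChain) : Type := {d : ℤ // d ∈ Finset.Icc (1 : ℤ) R.Dmax}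

/-- States `(v¹², v²³, m¹², m²³, Δᵉ)`. -/
@[ext] structure State (R : RepeaterChain) where
  v12 : Fin 2
  v23 : Fin 2
  m12 : R.LinkAge
  m23 : R.LinkAge
  aoe : R.AoE

/-- States as tuples. -/
def stateEquiv (R : RepeaterChain) :
    (Fin 2 × Fin 2) × (R.LinkAge × R.LinkAge) × R.AoE ≃ R.State where
  toFun x := ⟨x.1.1, x.1.2, x.2.1.1, x.2.1.2, x.2.2⟩
  invFun s := ((s.v12, s.v23), (s.m12, s.m23), s.aoe)
  left_inv _ := rfl
  right_inv _ := rfl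

instance (R : RepeaterChain) : Fintype R.State := Fintype.ofEquiv _ R.stateEquiv

instance (R : RepeaterChain) : DecidableEq R.State := R.stateEquiv.symm.decidableEq

/-- Actions `(a¹², a²³, aˢʷ)`. -/
@[ext] structure Action where
  a12 : Fin 2
  a23 : Fin 2
  sw : Fin 2

/-- Actions as tuples. -/
def actionEquiv : Fin 2 × Fin 2 × Fin 2 ≃ Action where
  toFun x := ⟨x.1, x.2.1, x.2.2⟩
  invFun a := (a.a12, a.a23, a.sw)
  left_inv _ := rfl
  right_inv _ := rfl

instance : Fintype Action := Fintype.ofEquiv _ actionEquiv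

instance : DecidableEq Action := actionEquiv.symm.decidableEq

/-- Admissible actions: no generation during a swap, generation only on visible links, and a swap
only when both links exist. -/
def Admissible (R : RepeaterChain) (s : R.State) (a : Action) : Prop :=
  (a.sw = 1 → a.a12 = 0 ∧ a.a23 = 0) ∧ (a.a12 = 1 → s.v12 = 1) ∧ (a.a23 = 1 → s.v23 = 1) ∧
    (a.sw = 1 → 1 ≤ s.m12.1 ∧ 1 ≤ s.m23.1)

/-- The aging operator of an elementary link. -/
def age (R : RepeaterChain) (m : ℤ) : ℤ := if 1 ≤ m ∧ m + 1 ≤ R.mstar then m + 1 else -1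

/-- Probability that a link of age `m` has age `m'` in the next slot, without a swap and with
generation request `a`. -/
def linkProb (R : RepeaterChain) (a : Fin 2) (m m' : ℤ) : ℝ :=
  if a = 1 then (if m' = 1 then R.pL else if m' = -1 then 1 - R.pL else 0)
  else if m' = R.age m then 1 else 0

/-- The capped age of entanglement after a slot without a successful swap. -/
def aoeNext (R : RepeaterChain) (s : R.State) : ℤ := min (s.aoe.1 + 1) R.Dmax

/-- The capped age of entanglement after a successful swap. -/
def aoeReset (R : RepeaterChain) (s : R.State) : ℤ := min (s.m12.1 + s.m23.1) R.Dmax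

/-- Joint transition probability of the two link ages and the age of entanglement. -/
def linkStateProb (R : RepeaterChain) (s : R.State) (a : Action) (m12' m23' d' : ℤ) : ℝ :=
  if a.sw = 1 then
    (if m12' = -1 then 1 else 0) * (if m23' = -1 then 1 else 0) *
      (R.psw * (if d' = R.aoeReset s then 1 else 0) +
        (1 - R.psw) * (if d' = R.aoeNext s then 1 else 0))
  else
    R.linkProb a.a12 s.m12.1 m12' * R.linkProb a.a23 s.m23.1 m23' *
      (if d' = R.aoeNext s then 1 else 0)

/-- Transition probability `P(s' | s, a)`. -/
def trans (R : RepeaterChain) (s : R.State) (a : Action) (s' : R.State) : ℝ :=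
  R.P12 s.v12 s'.v12 * R.P23 s.v23 s'.v23 * R.linkStateProb s a s'.m12.1 s'.m23.1 s'.aoe.1

lemma linkProb_nonneg (R : RepeaterChain) (a : Fin 2) (m m' : ℤ) : 0 ≤ R.linkProb a m m' := by
  have := R.pL_nonneg
  have := R.pL_le_one
  unfold linkProb
  split_ifs <;> linarith

lemma trans_nonneg (R : RepeaterChain) (s : R.State) (a : Action) (s' : R.State) :
    0 ≤ R.trans s a s' := by
  have h1 := R.psw_nonneg
  have h2 : 0 ≤ 1 - R.psw := by linarith [R.psw_le_one]
  unfold trans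
  refine mul_nonneg (mul_nonneg (R.P12_nonneg _ _) (R.P23_nonneg _ _)) ?_
  unfold linkStateProb
  have i0 : ∀ (p : Prop) [Decidable p], (0 : ℝ) ≤ if p then 1 else 0 := by
    intro p _; split_ifs <;> norm_num
  by_cases h : a.sw = 1
  · rw [if_pos h]
    exact mul_nonneg (mul_nonneg (i0 _) (i0 _))
      (add_nonneg (mul_nonneg h1 (i0 _)) (mul_nonneg h2 (i0 _)))
  · rw [if_neg h]
    exact mul_nonneg (mul_nonneg (R.linkProb_nonneg _ _ _) (R.linkProb_nonneg _ _ _)) (i0 _)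

lemma sum_indicator (F : Finset ℤ) (z : ℤ) (hz : z ∈ F) :
    ∑ x : {x : ℤ // x ∈ F}, (if x.1 = z then (1 : ℝ) else 0) = 1 := by
  rw [Finset.sum_eq_single (⟨z, hz⟩ : {x : ℤ // x ∈ F})]
  · simp
  · intro b _ hb
    rw [if_neg]
    intro e
    exact hb (Subtype.ext e)
  · simp

lemma linkProb_sum (R : RepeaterChain) (a : Fin 2) (m : ℤ) :
    ∑ m' : R.LinkAge, R.linkProb a m m'.1 = 1 := by
  have hm : (1 : ℤ) ≤ R.mstar := by exact_mod_cast R.one_le_mstar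
  by_cases h : a = 1
  · have e : ∀ m' : R.LinkAge, R.linkProb a m m'.1 =
        R.pL * (if m'.1 = 1 then 1 else 0) + (1 - R.pL) * (if m'.1 = -1 then 1 else 0) := by
      intro m'
      unfold linkProb
      rw [if_pos h]
      by_cases h1 : m'.1 = 1
      · simp [h1]
      · simp [h1]
    simp only [e]
    rw [Finset.sum_add_distrib, ← Finset.mul_sum, ← Finset.mul_sum,
      sum_indicator _ _ (by simp; omega), sum_indicator _ _ (by simp)]
    ring
  · simp only [linkProb, if_neg h]
    refine sum_indicator _ _ ?_
    unfold age
    split_ifs with h2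
    · simp; omega
    · simp

lemma aoeNext_mem (R : RepeaterChain) (s : R.State) :
    R.aoeNext s ∈ Finset.Icc (1 : ℤ) R.Dmax := by
  have h := Finset.mem_Icc.1 s.aoe.2
  rw [Finset.mem_Icc]
  unfold aoeNext
  omega

lemma trans_sum (R : RepeaterChain) (s : R.State) (a : Action) (ha : R.Admissible s a) :
    ∑ s', R.trans s a s' = 1 := by
  have hD : (1 : ℤ) ≤ R.Dmax := by exact_mod_cast R.one_le_Dmax
  rw [← R.stateEquiv.sum_comp]
  simp only [Fintype.sum_prod_type, trans, stateEquiv, Equiv.coe_fn_mk]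
  simp only [← Finset.mul_sum]
  have key : ∑ x : R.LinkAge, ∑ y : R.LinkAge, ∑ d : R.AoE,
      R.linkStateProb s a x.1 y.1 d.1 = 1 := by
    unfold linkStateProb
    by_cases h : a.sw = 1
    · have h4 := ha.2.2.2 h
      simp only [if_pos h, ← Finset.mul_sum, Finset.sum_add_distrib]
      rw [sum_indicator _ _ (R.aoeNext_mem s), sum_indicator _ (R.aoeReset s)
        (by rw [Finset.mem_Icc]; unfold aoeReset; omega)]
      simp only [← Finset.sum_mul, ← Finset.mul_sum]
      rw [sum_indicator _ _ (by simp)]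
      ring
    · simp only [if_neg h, ← Finset.mul_sum]
      rw [sum_indicator _ _ (R.aoeNext_mem s)]
      simp only [mul_one, ← Finset.mul_sum, linkProb_sum]
  rw [key]
  simp only [mul_one, ← Finset.mul_sum, R.P23_sum, R.P12_sum]

open Classical in
/-- The Markov decision process of the repeater chain, with reward minus the next age of
entanglement. -/
def mdp (R : RepeaterChain) : FiniteMDP R.State Action where
  adm s := Finset.univ.filter (fun a => R.Admissible s a)
  P := R.trans
  r _ _ s' := -(s'.aoe.1 : ℝ)
  adm_nonempty s := ⟨⟨0, 0, 0⟩, Finset.mem_filter.2 ⟨Finset.mem_univ _, by simp [Admissible]⟩⟩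
  P_nonneg s a _ s' := R.trans_nonneg s a s'
  P_sum s a ha := R.trans_sum s a (Finset.mem_filter.1 ha).2

end RepeaterChain

end

noncomputable section

set_option linter.unusedSectionVars false

namespace FiniteMDP

variable {S A : Type} [Fintype S] [DecidableEq S] [Fintype A] [DecidableEq A]

/-! ### The Bellman operator -/

/-! In every slot, whatever the action, both links become invisible with probability at least some
`δ > 0`. While they stay invisible nothing can be generated, so the existing links age out or are
consumed by a swap, and afterwards the age of entanglement climbs to its cap. Hence within `N = Dmax
+ mstar + 1` slots every policy, from every state, reaches the single state `restState` with
probability at least `δ ^ N`. The integer `potential` records this: `potential_drop` shows that it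
falls whenever the next state is invisible.

Such a common target makes the `N`-th power of the Bellman operator a contraction of the oscillation
with factor `1 - δ ^ N` (`osc_iterate_bellman_sub_le`, `oscContracting_mdp`). RVI is value iteration
normalised at the reference state, so its increments are summable and it converges to a solution of
`g + h = Lh`.

Optimality follows by telescoping: a function `w` with `Lw ≤ g + w` bounds the mean reward of every
policy by `g + O(1/T)`, and the reverse inequality along `f` bounds that of `f` from below. Bounds
at every horizon settle both liminf criteria at once. A stopped iterate satisfies these inequalities
up to `ε` on each side, whence the loss `2 * ε`. Exact optimality of late iterates and of small
tolerances uses the finiteness of states and actions. -/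

lemma Q_le_bellman (M : FiniteMDP S A) (h : S → ℝ) (s : S) {a : A} (ha : a ∈ M.adm s) :
    M.Q h s a ≤ M.bellman h s :=
  Finset.le_sup' (M.Q h s) ha

lemma exists_Q_eq_bellman (M : FiniteMDP S A) (h : S → ℝ) (s : S) :
    ∃ a ∈ M.adm s, M.bellman h s = M.Q h s a :=
  Finset.exists_mem_eq_sup' (M.adm_nonempty s) (M.Q h s)

lemma IsGreedy.Q_eq_bellman {M : FiniteMDP S A} {h : S → ℝ} {f : M.Stationary}
    (hf : M.IsGreedy h f) (s : S) : M.Q h s (f.1 s) = M.bellman h s :=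
  le_antisymm (M.Q_le_bellman h s (f.2 s)) (Finset.sup'_le _ _ (hf s))

lemma exists_isGreedy (M : FiniteMDP S A) (h : S → ℝ) : ∃ f : M.Stationary, M.IsGreedy h f := by
  choose f hf hf' using M.exists_Q_eq_bellman h
  exact ⟨⟨f, hf⟩, fun s a ha => (M.Q_le_bellman h s ha).trans (hf' s).le⟩

lemma Q_sub (M : FiniteMDP S A) (u v : S → ℝ) (s : S) (a : A) :
    M.Q u s a - M.Q v s a = ∑ s', M.P s a s' * (u s' - v s') := by
  unfold Q
  rw [← Finset.sum_sub_distrib]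
  exact Finset.sum_congr rfl fun _ _ => by ring

/-- An action maximal for `u` is only a competitor for `v`, and in the difference of the two
`Q`-values the rewards cancel. -/
lemma bellman_sub_le (M : FiniteMDP S A) (u v : S → ℝ) (s : S) :
    ∃ a ∈ M.adm s, M.bellman u s - M.bellman v s ≤ ∑ s', M.P s a s' * (u s' - v s') := by
  obtain ⟨a, ha, e⟩ := M.exists_Q_eq_bellman u s
  refine ⟨a, ha, ?_⟩
  rw [← M.Q_sub, e]
  linarith [M.Q_le_bellman v s ha]

lemma bellman_sub_le_of_le (M : FiniteMDP S A) {u v : S → ℝ} {b : ℝ} (h : ∀ s, u s - v s ≤ b)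
    (s : S) : M.bellman u s - M.bellman v s ≤ b := by
  obtain ⟨a, ha, e⟩ := M.bellman_sub_le u v s
  refine e.trans ?_
  calc ∑ s', M.P s a s' * (u s' - v s') ≤ ∑ s', M.P s a s' * b :=
        Finset.sum_le_sum fun s' _ => mul_le_mul_of_nonneg_left (h s') (M.P_nonneg s a ha s')
    _ = b := by rw [← Finset.sum_mul, M.P_sum s a ha, one_mul]

lemma bellman_sub_const (M : FiniteMDP S A) (u : S → ℝ) (c : ℝ) (s : S) :
    M.bellman (fun s => u s - c) s = M.bellman u s - c := by
  have h1 := M.bellman_sub_le_of_le (u := u) (v := fun s => u s - c) (b := c) (by simp) s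
  have h2 := M.bellman_sub_le_of_le (u := fun s => u s - c) (v := u) (b := -c) (by simp) s
  linarith

lemma continuous_Q (M : FiniteMDP S A) (s : S) (a : A) : Continuous fun h => M.Q h s a := by
  unfold Q
  fun_prop

lemma continuous_bellman (M : FiniteMDP S A) (s : S) : Continuous fun h => M.bellman h s := by
  unfold bellman
  exact Continuous.finset_sup'_apply (M.adm_nonempty s) fun a _ => M.continuous_Q s a

/-! ### Contraction of the oscillation -/

/-- The difference between the largest and the smallest value. -/
def osc (w : S → ℝ) : ℝ := (⨆ s, w s) - ⨅ s, w s

lemma sub_le_osc (w : S → ℝ) (s t : S) : w s - w t ≤ osc w :=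
  sub_le_sub (le_ciSup (Set.finite_range w).bddAbove s) (ciInf_le (Set.finite_range w).bddBelow t)

lemma abs_sub_le_osc (w : S → ℝ) (s t : S) : |w s - w t| ≤ osc w :=
  abs_sub_le_iff.2 ⟨sub_le_osc w s t, sub_le_osc w t s⟩

/-- If, under every action, the potential `φ` drops with probability at least `p`, and `z` is the
only state of potential `0`, then `k` steps of value iteration give weight at least `p ^ k` to
`z`, at the states of potential at most `k`. -/
lemma iterate_bellman_sub_le (M : FiniteMDP S A) {φ : S → ℕ} {z : S} {p : ℝ} (hp : 0 ≤ p)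
    (hz : ∀ s, φ s = 0 → s = z)
    (hφ : ∀ k s, φ s ≤ k + 1 → ∀ a ∈ M.adm s,
      p ≤ ∑ s', M.P s a s' * if φ s' ≤ k then 1 else 0)
    {u v : S → ℝ} {b : ℝ} (hb : ∀ s, u s - v s ≤ b) (k : ℕ) :
    (∀ s, (M.bellman^[k] u) s - (M.bellman^[k] v) s ≤ b) ∧
    ∀ s, φ s ≤ k →
      (M.bellman^[k] u) s - (M.bellman^[k] v) s ≤ p ^ k * (u z - v z) + (1 - p ^ k) * b := by
  induction k with
  | zero =>
    refine ⟨hb, fun s hs => ?_⟩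
    simp [hz s (by omega)]
  | succ k ih =>
    obtain ⟨ih1, ih2⟩ := ih
    simp only [Function.iterate_succ_apply']
    refine ⟨M.bellman_sub_le_of_le ih1, fun s hs => ?_⟩
    obtain ⟨a, ha, e⟩ := M.bellman_sub_le (M.bellman^[k] u) (M.bellman^[k] v) s
    refine e.trans ?_
    -- Gain over the trivial bound `b`: it is collected only at successors of potential at most `k`,
    -- which carry mass at least `p`.
    have hm := hφ k s hs a ha
    have hpk : 0 ≤ p ^ k * (b - (u z - v z)) :=
      mul_nonneg (pow_nonneg hp k) (by linarith [hb z])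
    have hle : ∀ s', (M.bellman^[k] u) s' - (M.bellman^[k] v) s' ≤
        b - (if φ s' ≤ k then 1 else 0) * (p ^ k * (b - (u z - v z))) := by
      intro s'
      split_ifs with h
      · linarith [ih2 s' h]
      · linarith [ih1 s']
    calc _ ≤ ∑ s', M.P s a s' * (b - (if φ s' ≤ k then 1 else 0) *
            (p ^ k * (b - (u z - v z)))) :=
          Finset.sum_le_sum fun s' _ => mul_le_mul_of_nonneg_left (hle s') (M.P_nonneg s a ha s')
      _ = b - (∑ s', M.P s a s' * if φ s' ≤ k then 1 else 0) *
            (p ^ k * (b - (u z - v z))) := by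
          simp only [mul_sub, Finset.sum_sub_distrib, ← Finset.sum_mul, M.P_sum s a ha, ← mul_assoc]
          ring
      _ ≤ b - p * (p ^ k * (b - (u z - v z))) := by
          linarith [mul_le_mul_of_nonneg_right hm hpk]
      _ = _ := by ring

/-- The one-sided estimate is used for `(u, v)` and for `(v, u)`. The term `p ^ N * (u z - v z)`
appears in both the upper and the lower bound and cancels in the oscillation. -/
lemma osc_iterate_bellman_sub_le [Nonempty S] (M : FiniteMDP S A) {φ : S → ℕ} {z : S} {p : ℝ}
    {N : ℕ} (hp : 0 ≤ p) (hz : ∀ s, φ s = 0 → s = z) (hN : ∀ s, φ s ≤ N)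
    (hφ : ∀ k s, φ s ≤ k + 1 → ∀ a ∈ M.adm s,
      p ≤ ∑ s', M.P s a s' * if φ s' ≤ k then 1 else 0) (u v : S → ℝ) :
    osc (fun s => (M.bellman^[N] u) s - (M.bellman^[N] v) s) ≤
      (1 - p ^ N) * osc (fun s => u s - v s) := by
  have hu := M.iterate_bellman_sub_le hp hz hφ (u := u) (v := v)
    (fun s => le_ciSup (Set.finite_range fun s => u s - v s).bddAbove s) N
  have hv := M.iterate_bellman_sub_le hp hz hφ (u := v) (v := u)
    (b := -⨅ s, (u s - v s))
    (fun s => by linarith [ciInf_le (Set.finite_range fun s => u s - v s).bddBelow s]) N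
  have h1 := ciSup_le fun s => hu.2 s (hN s)
  have h2 := le_ciInf (f := fun s => (M.bellman^[N] u) s - (M.bellman^[N] v) s)
    (c := p ^ N * (u z - v z) + (1 - p ^ N) * ⨅ s, (u s - v s))
    (fun s => by linarith [hv.2 s (hN s)])
  unfold osc
  linarith

/-- Some power of the Bellman operator contracts the oscillation. -/
def OscContracting (M : FiniteMDP S A) : Prop :=
  ∃ (N : ℕ) (α : ℝ), α < 1 ∧ ∀ u v : S → ℝ,
    osc (fun s => (M.bellman^[N] u) s - (M.bellman^[N] v) s) ≤ α * osc (fun s => u s - v s)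

lemma summable_of_shift_le {a : ℕ → ℝ} {N : ℕ} {α : ℝ} (ha : ∀ k, 0 ≤ a k) (hα : α < 1)
    (h : ∀ k, a (k + N) ≤ α * a k) : Summable a := by
  -- With `A` the sum of the first `N` terms, a partial sum `σ` satisfies `σ ≤ A + α * σ`, hence `σ
  -- ≤ A / (1 - α)`.
  refine summable_of_sum_range_le (c := (∑ k ∈ Finset.range N, a k) / (1 - α)) ha fun n => ?_
  rw [le_div_iff₀ (by linarith)]
  have h1 : ∑ k ∈ Finset.range n, a k ≤ ∑ k ∈ Finset.range (N + n), a k :=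
    Finset.sum_le_sum_of_subset_of_nonneg (Finset.range_mono (by omega)) fun k _ _ => ha k
  have h2 : ∑ k ∈ Finset.range n, a (N + k) ≤ ∑ k ∈ Finset.range n, α * a k :=
    Finset.sum_le_sum fun k _ => by rw [add_comm]; exact h k
  rw [Finset.sum_range_add] at h1
  rw [← Finset.mul_sum] at h2
  linarith

/-! ### Convergence of relative value iteration -/

/-- Subtracting a constant commutes with the Bellman operator, so the normalisations accumulated
along the way collapse into one. -/
lemma rvi_eq (M : FiniteMDP S A) (sref : S) (k : ℕ) (s : S) :
    M.rvi sref k s = (M.bellman^[k] fun _ => 0) s - (M.bellman^[k] fun _ => 0) sref := by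
  induction k generalizing s with
  | zero => simp [rvi]
  | succ k ih =>
    have e : M.rvi sref k = fun s => (M.bellman^[k] fun _ => 0) s -
      (M.bellman^[k] fun _ => 0) sref := funext ih
    simp only [rvi, e, Function.iterate_succ_apply', bellman_sub_const]
    ring

lemma OscContracting.exists_tendsto_rvi {M : FiniteMDP S A} (hM : M.OscContracting) (sref : S) :
    ∃ h : S → ℝ, Tendsto (M.rvi sref) atTop (𝓝 h) := by
  obtain ⟨N, α, hα, hc⟩ := hM
  have hs : Summable fun k => osc fun s => (M.bellman^[k + 1] fun _ => 0) s -
      (M.bellman^[k] fun _ => 0) s := by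
    refine summable_of_shift_le (N := N) (fun k => (abs_nonneg _).trans
      (abs_sub_le_osc _ sref sref)) hα fun k => ?_
    have := hc (M.bellman^[k + 1] fun _ => 0) (M.bellman^[k] fun _ => 0)
    simp only [← Function.iterate_add_apply] at this
    rwa [show N + (k + 1) = k + N + 1 by omega, add_comm N k] at this
  refine cauchySeq_tendsto_of_complete (cauchySeq_of_summable_dist
    (hs.of_nonneg_of_le (fun _ => dist_nonneg) fun k => ?_))
  rw [dist_pi_le_iff ((abs_nonneg _).trans (abs_sub_le_osc _ sref sref))]
  intro s
  rw [dist_comm, Real.dist_eq, rvi_eq, rvi_eq]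
  -- An RVI increment at `s` is the value iteration increment at `s` minus the one at `sref`, so the
  -- oscillation dominates it.
  refine le_of_eq_of_le (congrArg _ ?_) (abs_sub_le_osc _ s sref)
  ring

lemma rvi_limit_eq {M : FiniteMDP S A} {sref : S} {h : S → ℝ}
    (hh : Tendsto (M.rvi sref) atTop (𝓝 h)) (s : S) :
    M.bellman h sref + h s = M.bellman h s := by
  have h1 : Tendsto (fun k => M.rvi sref (k + 1) s) atTop
      (𝓝 (M.bellman h s - M.bellman h sref)) :=
    (((M.continuous_bellman s).tendsto h).comp hh).sub
      (((M.continuous_bellman sref).tendsto h).comp hh)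
  have h2 : Tendsto (fun k => M.rvi sref (k + 1) s) atTop (𝓝 (h s)) :=
    (tendsto_pi_nhds.1 hh s).comp (tendsto_add_atTop_nat 1)
  linarith [tendsto_nhds_unique h1 h2]

/-- A strict inequality between `Q`-values at the limit persists nearby, and only finitely many
triples `(s, a, b)` occur. An action that is suboptimal for `h` is thus eventually suboptimal for `x
k`. -/
lemma eventually_isGreedy_imp (M : FiniteMDP S A) {ι : Type*} {l : Filter ι} {x : ι → S → ℝ}
    {h : S → ℝ} (hx : Tendsto x l (𝓝 h)) :
    ∀ᶠ k in l, ∀ f : M.Stationary, M.IsGreedy (x k) f → M.IsGreedy h f := by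
  have key : ∀ s a b, ∀ᶠ k in l, M.Q h s a < M.Q h s b → M.Q (x k) s a < M.Q (x k) s b := by
    intro s a b
    by_cases hlt : M.Q h s a < M.Q h s b
    · exact ((((M.continuous_Q s a).tendsto h).comp hx).eventually_lt
        (((M.continuous_Q s b).tendsto h).comp hx) hlt).mono fun k hk _ => hk
    · exact Eventually.of_forall fun k hk => absurd hk hlt
  have key' : ∀ᶠ k in l, ∀ s a b, M.Q h s a < M.Q h s b → M.Q (x k) s a < M.Q (x k) s b := by
    simpa only [eventually_all] using key
  refine key'.mono fun k hk f hf s a ha => ?_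
  by_contra hlt
  exact absurd (hk s _ _ (not_le.1 hlt)) (not_lt.2 (hf s a ha))

/-! ### Expectations along a policy -/

/-- Expectation of `u (s_t)` under `π` from the initial state `s₀`. -/
def stateExpect (M : FiniteMDP S A) (π : M.Policy) (s₀ : S) (u : S → ℝ) (t : ℕ) : ℝ :=
  ∑ h : Fin t → S × A, ∑ s : S, M.pathProb π s₀ t h s * u s

/-- Inadmissible actions, about which the model assumes nothing, have weight zero, so comparisons
are needed on admissible actions only. -/
lemma Policy.prob_mul_le {M : FiniteMDP S A} (π : M.Policy) {t : ℕ} (h : Fin t → S × A) (s : S)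
    (a : A) {x y : ℝ} (hxy : a ∈ M.adm s → x ≤ y) : π.prob t h s a * x ≤ π.prob t h s a * y := by
  by_cases h0 : π.prob t h s a = 0
  · simp [h0]
  · exact mul_le_mul_of_nonneg_left (hxy (π.adm_of_ne_zero t h s a h0)) (π.nonneg t h s a)

lemma pathProb_nonneg (M : FiniteMDP S A) (π : M.Policy) (s₀ : S) (t : ℕ) (h : Fin t → S × A)
    (s : S) : 0 ≤ M.pathProb π s₀ t h s := by
  induction t generalizing s with
  | zero => unfold pathProb; split_ifs <;> norm_num
  | succ t ih =>
    unfold pathProb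
    by_cases h0 : π.prob t (Fin.init h) (h (Fin.last t)).1 (h (Fin.last t)).2 = 0
    · simp [h0]
    · exact mul_nonneg (mul_nonneg (ih _ _) (π.nonneg _ _ _ _))
        (M.P_nonneg _ _ (π.adm_of_ne_zero _ _ _ _ h0) _)

lemma sum_history_succ (t : ℕ) (F : (Fin (t + 1) → S × A) → ℝ) :
    ∑ h, F h = ∑ h : Fin t → S × A, ∑ s, ∑ a, F (Fin.snoc h (s, a)) := by
  rw [← (Fin.snocEquiv fun _ => S × A).sum_comp, Fintype.sum_prod_type, Finset.sum_comm]
  simp only [Fintype.sum_prod_type]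
  rfl

/-- Conditioning on the history and state at time `t` exposes the one-step averages to which Bellman
inequalities apply. -/
lemma expect_eq (M : FiniteMDP S A) (π : M.Policy) (s₀ : S) (c : S → A → S → ℝ) (t : ℕ) :
    M.expect π s₀ c t = ∑ h : Fin t → S × A, ∑ s, M.pathProb π s₀ t h s *
      ∑ a, π.prob t h s a * ∑ s', M.P s a s' * c s a s' := by
  unfold expect
  rw [sum_history_succ]
  simp only [pathProb, Fin.init_snoc, Fin.snoc_last, Finset.mul_sum]
  simp only [mul_assoc]

lemma expect_mono (M : FiniteMDP S A) (π : M.Policy) (s₀ : S) {c d : S → A → S → ℝ}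
    (h : ∀ s, ∀ a ∈ M.adm s, ∑ s', M.P s a s' * c s a s' ≤ ∑ s', M.P s a s' * d s a s') (t : ℕ) :
    M.expect π s₀ c t ≤ M.expect π s₀ d t := by
  rw [expect_eq, expect_eq]
  exact Finset.sum_le_sum fun _ _ => Finset.sum_le_sum fun s _ =>
    mul_le_mul_of_nonneg_left (Finset.sum_le_sum fun a _ => π.prob_mul_le _ s a (h s a))
      (M.pathProb_nonneg π s₀ t _ s)

lemma expect_stationary_mono (M : FiniteMDP S A) (f : M.Stationary) (s₀ : S)
    {c d : S → A → S → ℝ}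
    (h : ∀ s, ∑ s', M.P s (f.1 s) s' * c s (f.1 s) s' ≤ ∑ s', M.P s (f.1 s) s' * d s (f.1 s) s')
    (t : ℕ) : M.expect f.toPolicy s₀ c t ≤ M.expect f.toPolicy s₀ d t := by
  rw [expect_eq, expect_eq]
  refine Finset.sum_le_sum fun _ _ => Finset.sum_le_sum fun s _ =>
    mul_le_mul_of_nonneg_left ?_ (M.pathProb_nonneg _ s₀ t _ s)
  simpa [Stationary.toPolicy] using h s

lemma expect_add (M : FiniteMDP S A) (π : M.Policy) (s₀ : S) (c d : S → A → S → ℝ) (t : ℕ) :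
    M.expect π s₀ (fun s a s' => c s a s' + d s a s') t =
      M.expect π s₀ c t + M.expect π s₀ d t := by
  simp only [expect, mul_add, Finset.sum_add_distrib]

lemma expect_neg (M : FiniteMDP S A) (π : M.Policy) (s₀ : S) (c : S → A → S → ℝ) (t : ℕ) :
    M.expect π s₀ (fun s a s' => -c s a s') t = -M.expect π s₀ c t := by
  simp only [expect, mul_neg, Finset.sum_neg_distrib]

lemma expect_next (M : FiniteMDP S A) (π : M.Policy) (s₀ : S) (u : S → ℝ) (t : ℕ) :
    M.expect π s₀ (fun _ _ s' => u s') t = M.stateExpect π s₀ u (t + 1) := rfl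

lemma expect_current (M : FiniteMDP S A) (π : M.Policy) (s₀ : S) (u : S → ℝ) (t : ℕ) :
    M.expect π s₀ (fun s _ _ => u s) t = M.stateExpect π s₀ u t := by
  rw [expect_eq, stateExpect]
  refine Finset.sum_congr rfl fun h _ => Finset.sum_congr rfl fun s _ => ?_
  congr 1
  have : ∀ a, π.prob t h s a * ∑ s', M.P s a s' * u s = π.prob t h s a * u s := fun a =>
    le_antisymm (π.prob_mul_le h s a fun ha => by rw [← Finset.sum_mul, M.P_sum s a ha, one_mul])
      (π.prob_mul_le h s a fun ha => by rw [← Finset.sum_mul, M.P_sum s a ha, one_mul])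
  rw [Finset.sum_congr rfl fun a _ => this a, ← Finset.sum_mul, π.sum_eq_one, one_mul]

lemma stateExpect_zero (M : FiniteMDP S A) (π : M.Policy) (s₀ : S) (u : S → ℝ) :
    M.stateExpect π s₀ u 0 = u s₀ := by
  simp [stateExpect, pathProb]

lemma stateExpect_const (M : FiniteMDP S A) (π : M.Policy) (s₀ : S) (c : ℝ) (t : ℕ) :
    M.stateExpect π s₀ (fun _ => c) t = c := by
  induction t with
  | zero => exact M.stateExpect_zero π s₀ _
  | succ t ih => rw [← expect_next, M.expect_current π s₀ (fun _ => c), ih]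

lemma stateExpect_mono (M : FiniteMDP S A) (π : M.Policy) (s₀ : S) {u v : S → ℝ}
    (h : ∀ s, u s ≤ v s) (t : ℕ) : M.stateExpect π s₀ u t ≤ M.stateExpect π s₀ v t :=
  Finset.sum_le_sum fun _ _ => Finset.sum_le_sum fun s _ =>
    mul_le_mul_of_nonneg_left (h s) (M.pathProb_nonneg π s₀ t _ s)

lemma abs_stateExpect_le (M : FiniteMDP S A) (π : M.Policy) (s₀ : S) {u : S → ℝ} {C : ℝ}
    (h : ∀ s, |u s| ≤ C) (t : ℕ) : |M.stateExpect π s₀ u t| ≤ C := by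
  rw [abs_le]
  constructor
  · rw [← M.stateExpect_const π s₀ (-C) t]
    exact M.stateExpect_mono π s₀ (fun s => (abs_le.1 (h s)).1) t
  · rw [← M.stateExpect_const π s₀ C t]
    exact M.stateExpect_mono π s₀ (fun s => (abs_le.1 (h s)).2) t

lemma sum_P_mul_add (M : FiniteMDP S A) (w : S → ℝ) (s : S) {a : A} (ha : a ∈ M.adm s) (x : ℝ) :
    ∑ s' : S, M.P s a s' * (x + w s) = x + w s := by
  rw [← Finset.sum_mul, M.P_sum s a ha, one_mul]

/-- The hypothesis gives `E r_t ≤ g + E w(s_t) - E w(s_{t+1})`, which telescopes. -/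
lemma sum_expect_r_le (M : FiniteMDP S A) (π : M.Policy) (s₀ : S) {w : S → ℝ} {g : ℝ}
    (h : ∀ s, ∀ a ∈ M.adm s, M.Q w s a ≤ g + w s) (T : ℕ) :
    ∑ t ∈ Finset.range T, M.expect π s₀ M.r t ≤ T * g + w s₀ - M.stateExpect π s₀ w T := by
  induction T with
  | zero => simp [stateExpect_zero]
  | succ T ih =>
    have h1 : M.expect π s₀ (fun s a s' => M.r s a s' + w s') T ≤
        M.expect π s₀ (fun s _ _ => g + w s) T :=
      M.expect_mono π s₀ (fun s a ha => by rw [M.sum_P_mul_add w s ha]; exact h s a ha) T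
    rw [M.expect_add π s₀ M.r (fun _ _ s' => w s'), M.expect_add π s₀ (fun _ _ _ => g)
      (fun s _ _ => w s), M.expect_next π s₀ w, M.expect_current π s₀ w,
      M.expect_current π s₀ (fun _ => g), stateExpect_const] at h1
    rw [Finset.sum_range_succ]
    push_cast
    linarith

lemma le_sum_expect_r (M : FiniteMDP S A) (f : M.Stationary) (s₀ : S) {w : S → ℝ} {g : ℝ}
    (h : ∀ s, g + w s ≤ M.Q w s (f.1 s)) (T : ℕ) :
    T * g + w s₀ - M.stateExpect f.toPolicy s₀ w T ≤
      ∑ t ∈ Finset.range T, M.expect f.toPolicy s₀ M.r t := by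
  induction T with
  | zero => simp [stateExpect_zero]
  | succ T ih =>
    have h1 : M.expect f.toPolicy s₀ (fun s _ _ => g + w s) T ≤
        M.expect f.toPolicy s₀ (fun s a s' => M.r s a s' + w s') T :=
      M.expect_stationary_mono f s₀
        (fun s => by rw [M.sum_P_mul_add w s (f.2 s)]; exact h s) T
    rw [M.expect_add _ s₀ M.r (fun _ _ s' => w s'), M.expect_add _ s₀ (fun _ _ _ => g)
      (fun s _ _ => w s), M.expect_next _ s₀ w, M.expect_current _ s₀ w,
      M.expect_current _ s₀ (fun _ => g), stateExpect_const] at h1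
    rw [Finset.sum_range_succ]
    push_cast
    linarith

/-! ### Verification: sub- and supersolutions of the optimality equation -/

/-- The expected average reward over the first `T` steps. -/
def meanReward (M : FiniteMDP S A) (π : M.Policy) (s₀ : S) (T : ℕ) : ℝ :=
  (1 / (T : ℝ)) * ∑ t ∈ Finset.range T, M.expect π s₀ M.r t

lemma avgReward_eq (M : FiniteMDP S A) (π : M.Policy) (s₀ : S) :
    M.avgReward π s₀ = liminf (M.meanReward π s₀) atTop := rfl

lemma avgCost_eq (M : FiniteMDP S A) (π : M.Policy) (s₀ : S) :
    M.avgCost π s₀ = liminf (fun T => -M.meanReward π s₀ T) atTop := by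
  unfold avgCost longRunAverage meanReward
  simp only [expect_neg, Finset.sum_neg_distrib, mul_neg]

lemma exists_abs_le (w : S → ℝ) : ∃ C, ∀ s, |w s| ≤ C := by
  obtain ⟨C, hC⟩ := (Set.finite_range fun s => |w s|).bddAbove
  exact ⟨C, fun s => hC ⟨s, rfl⟩⟩

/-- A real `liminf` is monotone only under boundedness conditions; this bound supplies them for
every policy. -/
lemma exists_abs_meanReward_le (M : FiniteMDP S A) (π : M.Policy) (s₀ : S) :
    ∃ B, ∀ T, |M.meanReward π s₀ T| ≤ B := by
  obtain ⟨B, hB⟩ := (Set.finite_range fun x : S × A × S => |M.r x.1 x.2.1 x.2.2|).bddAbove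
  have hB' : ∀ s a s', |M.r s a s'| ≤ B := fun s a s' => hB ⟨(s, a, s'), rfl⟩
  have hB0 : 0 ≤ B :=
    (abs_nonneg _).trans (hB' s₀ (M.adm_nonempty s₀).choose s₀)
  have hE : ∀ t, |M.expect π s₀ M.r t| ≤ B := by
    intro t
    rw [abs_le]
    constructor
    · rw [← M.stateExpect_const π s₀ (-B) t, ← M.expect_current]
      exact M.expect_mono π s₀ (fun s a ha => Finset.sum_le_sum fun s' _ =>
        mul_le_mul_of_nonneg_left (abs_le.1 (hB' s a s')).1 (M.P_nonneg s a ha s')) t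
    · rw [← M.stateExpect_const π s₀ B t, ← M.expect_current]
      exact M.expect_mono π s₀ (fun s a ha => Finset.sum_le_sum fun s' _ =>
        mul_le_mul_of_nonneg_left (abs_le.1 (hB' s a s')).2 (M.P_nonneg s a ha s')) t
  refine ⟨B, fun T => ?_⟩
  have h1 : |∑ t ∈ Finset.range T, M.expect π s₀ M.r t| ≤ T * B :=
    (Finset.abs_sum_le_sum_abs _ _).trans
      ((Finset.sum_le_sum fun t _ => hE t).trans (by simp))
  unfold meanReward
  rw [abs_mul, abs_of_nonneg (by positivity : (0 : ℝ) ≤ 1 / T)]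
  -- At `T = 0` the mean is `0`, since `1 / 0 = 0`.
  rcases Nat.eq_zero_or_pos T with rfl | hT
  · simpa using hB0
  · have hT' : (0 : ℝ) < T := by exact_mod_cast hT
    rw [one_div, inv_mul_le_iff₀ hT']
    exact h1

lemma tendsto_add_div (g C : ℝ) : Tendsto (fun T : ℕ => g + C / T) atTop (𝓝 g) := by
  simpa using (tendsto_const_nhds (x := g)).add (tendsto_const_div_atTop_nhds_zero_nat C)

lemma exists_meanReward_le (M : FiniteMDP S A) (π : M.Policy) (s₀ : S) {w : S → ℝ} {g : ℝ}
    (h : ∀ s, ∀ a ∈ M.adm s, M.Q w s a ≤ g + w s) :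
    ∃ C : ℝ, ∀ᶠ T : ℕ in atTop, M.meanReward π s₀ T ≤ g + C / T := by
  obtain ⟨C, hC⟩ := exists_abs_le w
  refine ⟨2 * C, (eventually_gt_atTop 0).mono fun T hT => ?_⟩
  have hT' : (0 : ℝ) < T := by exact_mod_cast hT
  have h1 := M.sum_expect_r_le π s₀ h T
  have h2 := (abs_le.1 (M.abs_stateExpect_le π s₀ hC T)).1
  have h3 := (abs_le.1 (hC s₀)).2
  unfold meanReward
  rw [one_div, inv_mul_le_iff₀ hT', mul_add, mul_div_cancel₀ _ hT'.ne']
  linarith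

lemma exists_le_meanReward (M : FiniteMDP S A) (f : M.Stationary) (s₀ : S) {w : S → ℝ} {g : ℝ}
    (h : ∀ s, g + w s ≤ M.Q w s (f.1 s)) :
    ∃ C : ℝ, ∀ᶠ T : ℕ in atTop, g + C / T ≤ M.meanReward f.toPolicy s₀ T := by
  obtain ⟨C, hC⟩ := exists_abs_le w
  refine ⟨-(2 * C), (eventually_gt_atTop 0).mono fun T hT => ?_⟩
  have hT' : (0 : ℝ) < T := by exact_mod_cast hT
  have h1 := M.le_sum_expect_r f s₀ h T
  have h2 := (abs_le.1 (M.abs_stateExpect_le f.toPolicy s₀ hC T)).2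
  have h3 := (abs_le.1 (hC s₀)).1
  unfold meanReward
  rw [one_div, le_inv_mul_iff₀ hT', mul_add, mul_div_cancel₀ _ hT'.ne']
  linarith

lemma liminf_le_of_le_tendsto {x y : ℕ → ℝ} {g B : ℝ} (hx : ∀ T, |x T| ≤ B)
    (hy : Tendsto y atTop (𝓝 g)) (h : ∀ᶠ T in atTop, x T ≤ y T) : liminf x atTop ≤ g := by
  rw [← hy.liminf_eq]
  exact liminf_le_liminf h (isBoundedUnder_of ⟨-B, fun T => (abs_le.1 (hx T)).1⟩)
    hy.isBoundedUnder_le.isCoboundedUnder_ge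

lemma le_liminf_of_tendsto_le {x y : ℕ → ℝ} {g B : ℝ} (hx : ∀ T, |x T| ≤ B)
    (hy : Tendsto y atTop (𝓝 g)) (h : ∀ᶠ T in atTop, y T ≤ x T) : g ≤ liminf x atTop := by
  rw [← hy.liminf_eq]
  exact liminf_le_liminf h hy.isBoundedUnder_ge
    (isBoundedUnder_of ⟨B, fun T => (abs_le.1 (hx T)).2⟩ :
      IsBoundedUnder (· ≤ ·) atTop x).isCoboundedUnder_ge

lemma avgReward_le_and_le_avgCost (M : FiniteMDP S A) (π : M.Policy) (s₀ : S) {w : S → ℝ} {g : ℝ}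
    (h : ∀ s, ∀ a ∈ M.adm s, M.Q w s a ≤ g + w s) :
    M.avgReward π s₀ ≤ g ∧ -g ≤ M.avgCost π s₀ := by
  obtain ⟨B, hB⟩ := M.exists_abs_meanReward_le π s₀
  obtain ⟨C, hC⟩ := M.exists_meanReward_le π s₀ h
  rw [avgReward_eq, avgCost_eq]
  exact ⟨liminf_le_of_le_tendsto hB (tendsto_add_div g C) hC,
    le_liminf_of_tendsto_le (by simpa using hB) (tendsto_add_div g C).neg
      (hC.mono fun T hT => neg_le_neg hT)⟩

lemma le_avgReward_and_avgCost_le (M : FiniteMDP S A) (f : M.Stationary) (s₀ : S) {w : S → ℝ}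
    {g : ℝ} (h : ∀ s, g + w s ≤ M.Q w s (f.1 s)) :
    g ≤ M.avgReward f.toPolicy s₀ ∧ M.avgCost f.toPolicy s₀ ≤ -g := by
  obtain ⟨B, hB⟩ := M.exists_abs_meanReward_le f.toPolicy s₀
  obtain ⟨C, hC⟩ := M.exists_le_meanReward f s₀ h
  rw [avgReward_eq, avgCost_eq]
  exact ⟨le_liminf_of_tendsto_le hB (tendsto_add_div g C) hC,
    liminf_le_of_le_tendsto (by simpa using hB) (tendsto_add_div g C).neg
      (hC.mono fun T hT => neg_le_neg hT)⟩

lemma IsGreedy.isAverageOptimal {M : FiniteMDP S A} {h : S → ℝ} {g : ℝ} {f : M.Stationary}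
    (hf : M.IsGreedy h f) (hg : ∀ s, g + h s = M.bellman h s) :
    M.IsAverageOptimal f.toPolicy ∧ ∀ s, M.avgReward f.toPolicy s = g := by
  have up : ∀ π s, M.avgReward π s ≤ g ∧ -g ≤ M.avgCost π s := fun π s =>
    M.avgReward_le_and_le_avgCost π s fun s a ha => (hg s).symm ▸ M.Q_le_bellman h s ha
  have lo : ∀ s, g ≤ M.avgReward f.toPolicy s ∧ M.avgCost f.toPolicy s ≤ -g := fun s =>
    M.le_avgReward_and_avgCost_le f s fun s => (hg s).trans_le (hf.Q_eq_bellman s).ge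
  exact ⟨fun π s => ⟨(up π s).1.trans (lo s).1, (lo s).2.trans (up π s).2⟩,
    fun s => le_antisymm (up _ s).1 (lo s).1⟩

/-- The same `h` is a supersolution with constant `c + ε` and, along `f`, a subsolution with
constant `c - ε`. -/
lemma IsGreedy.avgReward_le_add {M : FiniteMDP S A} {h : S → ℝ} {c ε : ℝ} {f : M.Stationary}
    (hf : M.IsGreedy h f) (hc : ∀ s, |M.bellman h s - c - h s| < ε) (π : M.Policy) (s : S) :
    M.avgReward π s ≤ M.avgReward f.toPolicy s + 2 * ε := by
  have up := M.avgReward_le_and_le_avgCost π s (w := h) (g := c + ε) fun s a ha => by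
    linarith [M.Q_le_bellman h s ha, (abs_lt.1 (hc s)).2]
  have lo := M.le_avgReward_and_avgCost_le f s (w := h) (g := c - ε) fun s => by
    linarith [(hf.Q_eq_bellman s).ge, (abs_lt.1 (hc s)).1]
  linarith [up.1, lo.1]

/-! ### The stopping test -/

lemma exists_isRVIOutput {M : FiniteMDP S A} {sref : S} {h : S → ℝ}
    (hh : Tendsto (M.rvi sref) atTop (𝓝 h)) {ε : ℝ} (hε : 0 < ε) :
    ∃ f : M.Stationary, M.IsRVIOutput sref ε f := by
  have hd : Tendsto (fun k => M.rvi sref (k + 1) - M.rvi sref k) atTop (𝓝 0) := by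
    simpa using (hh.comp (tendsto_add_atTop_nat 1)).sub hh
  have he : ∀ᶠ k in atTop, ∀ s, |M.rvi sref (k + 1) s - M.rvi sref k s| < ε := by
    rw [eventually_all]
    intro s
    have := (tendsto_pi_nhds.1 hd s).abs
    simp only [Pi.zero_apply, abs_zero, Pi.sub_apply] at this
    exact this.eventually_lt_const hε
  obtain ⟨k, hk⟩ := he.exists
  have hne : (M.rviStopSet sref ε).Nonempty := ⟨k + 1, by omega, hk⟩
  obtain ⟨f, hf⟩ := M.exists_isGreedy (M.rvi sref (sInf (M.rviStopSet sref ε) - 1))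
  exact ⟨f, _, ⟨Nat.sInf_mem hne, fun _ => Nat.sInf_le⟩, hf⟩

lemma IsRVIOutput.exists_lt {M : FiniteMDP S A} {sref : S} {ε : ℝ} {f : M.Stationary}
    (hf : M.IsRVIOutput sref ε f) :
    ∃ k, (∀ s, |M.rvi sref (k + 1) s - M.rvi sref k s| < ε) ∧ M.IsGreedy (M.rvi sref k) f := by
  obtain ⟨k, ⟨⟨hk, h⟩, -⟩, hg⟩ := hf
  refine ⟨k - 1, ?_, hg⟩
  rwa [Nat.sub_add_cancel hk]

lemma IsRVIOutput.avgReward_le_add {M : FiniteMDP S A} {sref : S} {ε : ℝ} {f : M.Stationary}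
    (hf : M.IsRVIOutput sref ε f) (π : M.Policy) (s : S) :
    M.avgReward π s ≤ M.avgReward f.toPolicy s + 2 * ε := by
  obtain ⟨k, hk, hg⟩ := hf.exists_lt
  -- By definition of `rvi`, the stopping test is the hypothesis on `h` with `c = M.bellman (M.rvi
  -- sref k) sref`.
  exact hg.avgReward_le_add hk π s

/-- Take `ε₀` below every nonzero increment among the first `K` iterations. A stop there then forces
two consecutive iterates to coincide, so the iterate solves the optimality equation exactly; a later
stop is covered by `hK`. -/
lemma exists_isRVIOutput_isAverageOptimal {M : FiniteMDP S A} {sref : S} {K : ℕ}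
    (hK : ∀ k ≥ K, ∀ f : M.Stationary,
      M.IsGreedy (M.rvi sref k) f → M.IsAverageOptimal f.toPolicy) :
    ∃ ε₀ : ℝ, 0 < ε₀ ∧ ∀ ε : ℝ, 0 < ε → ε < ε₀ → ∀ f : M.Stationary,
      M.IsRVIOutput sref ε f → M.IsAverageOptimal f.toPolicy := by
  have he : ∀ᶠ ε : ℝ in 𝓝[>] 0, ∀ k ∈ Finset.range K, ∀ s,
      M.rvi sref (k + 1) s ≠ M.rvi sref k s →
        ε < |M.rvi sref (k + 1) s - M.rvi sref k s| := by
    rw [eventually_all_finset]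
    intro k _
    rw [eventually_all]
    intro s
    by_cases h0 : M.rvi sref (k + 1) s = M.rvi sref k s
    · exact Eventually.of_forall fun _ h => absurd h0 h
    · exact (eventually_nhdsWithin_of_eventually_nhds
        (eventually_lt_nhds (abs_pos.2 (sub_ne_zero.2 h0)))).mono fun _ h _ => h
  obtain ⟨ε₀, h0, hε₀⟩ := (mem_nhdsGT_iff_exists_Ioo_subset).1 he
  refine ⟨ε₀, h0, fun ε hε hlt f hf => ?_⟩
  obtain ⟨k, hk, hg⟩ := hf.exists_lt
  by_cases hkK : K ≤ k
  · exact hK k hkK f hg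
  · refine (hg.isAverageOptimal (g := M.bellman (M.rvi sref k) sref) fun s => ?_).1
    have e : M.rvi sref (k + 1) s = M.rvi sref k s := by
      by_contra hne
      exact lt_asymm (hk s) (hε₀ ⟨hε, hlt⟩ k (Finset.mem_range.2 (not_le.1 hkK)) s hne)
    rw [← e]
    simp [rvi]

end FiniteMDP

/-! ### The repeater chain: reaching the rest state under every policy -/

namespace RepeaterChain

/-- The number of further slots for which a link of age `m` survives without generation. -/
def linkLife (R : RepeaterChain) (m : ℤ) : ℤ := if 1 ≤ m then R.mstar + 1 - m else 0

/-- The largest number of slots until both links are lost and the age of entanglement is maximal,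
if from the next slot on both links are invisible. -/
def potential (R : RepeaterChain) (s : R.State) : ℕ :=
  if s.v12 = 0 ∧ s.v23 = 0 then
    if s.m12.1 = -1 ∧ s.m23.1 = -1 then (R.Dmax - s.aoe.1).toNat
    else R.Dmax + (max (R.linkLife s.m12.1) (R.linkLife s.m23.1)).toNat
  else R.Dmax + R.mstar + 1

/-- The state without visibility and links and with maximal age of entanglement. -/
def restState (R : RepeaterChain) : R.State :=
  ⟨0, 0, ⟨-1, by simp⟩, ⟨-1, by simp⟩,
    ⟨R.Dmax, Finset.mem_Icc.2 ⟨by exact_mod_cast R.one_le_Dmax, le_rfl⟩⟩⟩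

lemma linkAge_cases (R : RepeaterChain) (m : R.LinkAge) :
    m.1 = -1 ∨ 1 ≤ m.1 ∧ m.1 ≤ R.mstar := by
  obtain ⟨m, hm⟩ := m
  rw [Finset.mem_insert, Finset.mem_Icc] at hm
  exact hm

lemma eq_restState_of_potential_eq_zero (R : RepeaterChain) (s : R.State)
    (hs : R.potential s = 0) : s = R.restState := by
  have hD := R.one_le_Dmax
  have hd := Finset.mem_Icc.1 s.aoe.2
  unfold potential at hs
  split_ifs at hs with h1 h2
  · exact State.ext h1.1 h1.2 (Subtype.ext h2.1) (Subtype.ext h2.2)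
      (Subtype.ext (show s.aoe.1 = R.Dmax by omega))
  · omega

lemma potential_le_of_invisible (R : RepeaterChain) (s : R.State) (hv : s.v12 = 0 ∧ s.v23 = 0) :
    R.potential s ≤ R.Dmax + R.mstar := by
  have hd := Finset.mem_Icc.1 s.aoe.2
  have h1 := R.linkAge_cases s.m12
  have h2 := R.linkAge_cases s.m23
  unfold potential linkLife
  rw [if_pos hv]
  split_ifs <;> omega

lemma potential_le (R : RepeaterChain) (s : R.State) :
    R.potential s ≤ R.Dmax + R.mstar + 1 := by
  by_cases hv : s.v12 = 0 ∧ s.v23 = 0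
  · exact (R.potential_le_of_invisible s hv).trans (by omega)
  · simp [potential, hv]

lemma eq_age_of_linkProb_ne_zero (R : RepeaterChain) {m m' : ℤ} (h : R.linkProb 0 m m' ≠ 0) :
    m' = R.age m := by
  by_contra hne
  simp [linkProb, hne] at h

lemma linkStateProb_ne_zero (R : RepeaterChain) {s : R.State} {a : Action} {m12' m23' d' : ℤ}
    (h : R.linkStateProb s a m12' m23' d' ≠ 0) :
    (a.sw = 1 ∧ m12' = -1 ∧ m23' = -1) ∨
      (R.linkProb a.a12 s.m12.1 m12' ≠ 0 ∧ R.linkProb a.a23 s.m23.1 m23' ≠ 0 ∧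
        a.sw ≠ 1 ∧ d' = R.aoeNext s) := by
  unfold linkStateProb at h
  split_ifs at h <;> simp_all

/-- Only the visibility of `s'` is left to chance: the other random outcomes, namely generation from
a visible state and the result of a swap, all lower the potential. With `hs` of the form `≤ k + 1`,
potential `0` is allowed to stay at `0`. -/
lemma potential_drop (R : RepeaterChain) {s s' : R.State} {a : Action} (ha : R.Admissible s a)
    {k : ℕ} (hs : R.potential s ≤ k + 1) (h : R.trans s a s' ≠ 0)
    (hv' : s'.v12 = 0 ∧ s'.v23 = 0) : R.potential s' ≤ k := by
  by_cases hv : s.v12 = 0 ∧ s.v23 = 0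
  · have hl := R.linkStateProb_ne_zero (right_ne_zero_of_mul h)
    obtain ⟨-, h12, h23, hsw⟩ := ha
    have ha12 : a.a12 = 0 := by
      by_contra h0
      have := h12 (by omega)
      simp [hv.1] at this
    have ha23 : a.a23 = 0 := by
      by_contra h0
      have := h23 (by omega)
      simp [hv.2] at this
    have hd := Finset.mem_Icc.1 s.aoe.2
    have hd' := Finset.mem_Icc.1 s'.aoe.2
    have h1 := R.linkAge_cases s.m12
    have h2 := R.linkAge_cases s.m23
    unfold potential at hs ⊢
    rw [if_pos hv] at hs
    rw [if_pos hv']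
    rcases hl with ⟨hsw1, e12, e23⟩ | ⟨e12, e23, -, ed⟩
    -- A swap requires both links, so the potential exceeded `Dmax`; without links it is below
    -- `Dmax`, even if the age of entanglement was reset.
    · have := hsw hsw1
      rw [if_pos ⟨e12, e23⟩]
      rw [if_neg (by omega)] at hs
      unfold linkLife at hs
      split_ifs at hs <;> omega
    · rw [ha12] at e12
      rw [ha23] at e23
      replace e12 := R.eq_age_of_linkProb_ne_zero e12
      replace e23 := R.eq_age_of_linkProb_ne_zero e23
      unfold age at e12 e23
      unfold aoeNext at ed
      unfold linkLife at hs ⊢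
      -- Either a link remains and the longer life has shrunk by one, or the last link was just
      -- lost, or there was none and the age of entanglement grew towards its cap.
      split_ifs at * <;> omega
  -- From a state with a visible link the action may create fresh links; the value `Dmax + mstar +
  -- 1` exceeds that of every invisible state.
  · have := R.potential_le_of_invisible s' hv'
    simp only [potential, hv, if_false] at hs
    omega

lemma linkStateProb_sum (R : RepeaterChain) (s : R.State) (a : Action) (ha : R.Admissible s a) :
    ∑ x : R.LinkAge, ∑ y : R.LinkAge, ∑ d : R.AoE, R.linkStateProb s a x.1 y.1 d.1 = 1 := by
  have hD : (1 : ℤ) ≤ R.Dmax := by exact_mod_cast R.one_le_Dmax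
  unfold linkStateProb
  by_cases h : a.sw = 1
  · have h4 := ha.2.2.2 h
    simp only [if_pos h, ← Finset.mul_sum, Finset.sum_add_distrib]
    rw [sum_indicator _ _ (R.aoeNext_mem s), sum_indicator _ (R.aoeReset s)
      (by rw [Finset.mem_Icc]; unfold aoeReset; omega)]
    simp only [← Finset.sum_mul, ← Finset.mul_sum]
    rw [sum_indicator _ _ (by simp)]
    ring
  · simp only [if_neg h, ← Finset.mul_sum]
    rw [sum_indicator _ _ (R.aoeNext_mem s)]
    simp only [mul_one, ← Finset.mul_sum, linkProb_sum]

lemma sum_trans_invisible (R : RepeaterChain) (s : R.State) (a : Action)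
    (ha : R.Admissible s a) :
    ∑ s', R.trans s a s' * (if s'.v12 = 0 ∧ s'.v23 = 0 then 1 else 0) =
      R.P12 s.v12 0 * R.P23 s.v23 0 := by
  rw [← R.stateEquiv.sum_comp]
  simp only [Fintype.sum_prod_type, trans, stateEquiv, Equiv.coe_fn_mk]
  simp only [← Finset.mul_sum, ← Finset.sum_mul, R.linkStateProb_sum s a ha, Fin.sum_univ_two]
  simp

lemma exists_pos_le_of_pos {P : Matrix (Fin 2) (Fin 2) ℝ} (h : ∀ i, 0 < P i 0) :
    ∃ p : ℝ, 0 < p ∧ ∀ i, p ≤ P i 0 :=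
  ⟨min (P 0 0) (P 1 0), lt_min (h 0) (h 1), fun i => by fin_cases i <;> simp⟩

lemma oscContracting_mdp (R : RepeaterChain) (h12 : ∀ i, 0 < R.P12 i 0)
    (h23 : ∀ i, 0 < R.P23 i 0) : R.mdp.OscContracting := by
  obtain ⟨p, hp, hp'⟩ := exists_pos_le_of_pos h12
  obtain ⟨q, hq, hq'⟩ := exists_pos_le_of_pos h23
  have : Nonempty R.State := ⟨R.restState⟩
  refine ⟨R.Dmax + R.mstar + 1, 1 - (p * q) ^ (R.Dmax + R.mstar + 1),
    sub_lt_self _ (by positivity), R.mdp.osc_iterate_bellman_sub_le (mul_pos hp hq).le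
      R.eq_restState_of_potential_eq_zero R.potential_le fun k s hs a ha => ?_⟩
  have ha' : R.Admissible s a := by
    classical exact (Finset.mem_filter.1 ha).2
  calc p * q ≤ R.P12 s.v12 0 * R.P23 s.v23 0 :=
        mul_le_mul (hp' _) (hq' _) hq.le (hp.le.trans (hp' _))
    _ = _ := (R.sum_trans_invisible s a ha').symm
    -- Among reachable successors, joint invisibility implies that the potential has dropped.
    _ ≤ _ := Finset.sum_le_sum fun s' _ => ?_
  change _ ≤ R.trans s a s' * _
  by_cases h0 : R.trans s a s' = 0
  · simp [h0]
  · refine mul_le_mul_of_nonneg_left ?_ (R.trans_nonneg s a s')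
    by_cases hv : s'.v12 = 0 ∧ s'.v23 = 0
    · rw [if_pos hv, if_pos (R.potential_drop ha' hs h0 hv)]
    · rw [if_neg hv]
      split_ifs <;> norm_num

end RepeaterChain

end

theorem theorem1 (R : RepeaterChain)
    (h12 : ∀ i, 0 < R.P12 i 0) (h23 : ∀ i, 0 < R.P23 i 0) :
    -- an optimal stationary deterministic policy exists
    (∃ f : R.mdp.Stationary, R.mdp.IsAverageOptimal f.toPolicy) ∧
    ∀ sref : R.State,
      -- the iterates converge to a solution of the optimality equation, and the policies which
      -- are greedy for the limit, or for any late iterate, are optimal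
      (∃ (g : ℝ) (h : R.State → ℝ),
        (∀ s, Tendsto (fun k => R.mdp.rvi sref k s) atTop (𝓝 (h s))) ∧
        (∀ s, g + h s = R.mdp.bellman h s) ∧
        (∀ f : R.mdp.Stationary, R.mdp.IsGreedy h f →
          R.mdp.IsAverageOptimal f.toPolicy ∧ ∀ s, R.mdp.avgReward f.toPolicy s = g)) ∧
      (∃ K : ℕ, ∀ k ≥ K, ∀ f : R.mdp.Stationary,
        R.mdp.IsGreedy (R.mdp.rvi sref k) f → R.mdp.IsAverageOptimal f.toPolicy) ∧
      -- the algorithm stops for every tolerance, its output is nearly optimal for every tolerance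
      -- and optimal for every small enough tolerance
      (∀ ε : ℝ, 0 < ε → ∃ f : R.mdp.Stationary, R.mdp.IsRVIOutput sref ε f) ∧
      (∀ ε : ℝ, 0 < ε → ∀ f : R.mdp.Stationary, R.mdp.IsRVIOutput sref ε f →
        ∀ (π' : R.mdp.Policy) (s : R.State),
          R.mdp.avgReward π' s ≤ R.mdp.avgReward f.toPolicy s + 2 * ε) ∧
      (∃ ε₀ : ℝ, 0 < ε₀ ∧ ∀ ε : ℝ, 0 < ε → ε < ε₀ → ∀ f : R.mdp.Stationary,
        R.mdp.IsRVIOutput sref ε f → R.mdp.IsAverageOptimal f.toPolicy) := by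
  have hM := R.oscContracting_mdp h12 h23
  refine ⟨?_, fun sref => ?_⟩
  -- Any reference state would do here; `restState` shows that one exists.
  · obtain ⟨h, hh⟩ := hM.exists_tendsto_rvi R.restState
    obtain ⟨f, hf⟩ := R.mdp.exists_isGreedy h
    exact ⟨f, (hf.isAverageOptimal (FiniteMDP.rvi_limit_eq hh)).1⟩
  · obtain ⟨h, hh⟩ := hM.exists_tendsto_rvi sref
    have hg := FiniteMDP.rvi_limit_eq hh
    obtain ⟨K, hK⟩ := eventually_atTop.1 (R.mdp.eventually_isGreedy_imp hh)
    have hopt : ∀ k ≥ K, ∀ f : R.mdp.Stationary,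
        R.mdp.IsGreedy (R.mdp.rvi sref k) f → R.mdp.IsAverageOptimal f.toPolicy :=
      fun k hk f hf => ((hK k hk f hf).isAverageOptimal hg).1
    exact ⟨⟨_, h, tendsto_pi_nhds.1 hh, hg, fun f hf => hf.isAverageOptimal hg⟩, ⟨K, hopt⟩,
      fun ε hε => FiniteMDP.exists_isRVIOutput hh hε,
      fun ε _ f hf => hf.avgReward_le_add,
      FiniteMDP.exists_isRVIOutput_isAverageOptimal hopt⟩
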